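/- For a finite set $E\subset\mathbb R^2$, an integer $k\ge 1$ and a $k$-tuple $(\alpha_1,\dots,\alpha_k)$ of real numbers, a \emph{$k$-chain of type $(\alpha_1,\dots,\alpha_k)$ in $E$} is a $(k+1)$-tuple $(R_1,\dots,R_{k+1})\in E^{k+1}$ with $R_j\cdot R_{j+1}=\alpha_j$ for all $j=1,\dots,k$, where $\cdot$ is the usual dot product (points may repeat in a tuple). \textbf{Theorem.} For every integer $k\ge 1$ there are constants $C$ and $N$, depending only on $k$, such that the following holds for all natural numbers $n>N$ and $t$, every set $E\subset\mathbb R^2$ of $n$ points with at most $t$ points on any line, and every $k$-tuple $(\alpha_1,\dots,\alpha_k)$ of nonzero real numbers: the number of $k$-chains of type $(\alpha_1,\dots,\alpha_k)$ in $E$ is at most $$ \begin{cases} C\,(\log_2 n)^{\frac{2k-6}{3}}\; t^{\frac{k-3}{3}}\; n^{\frac{4k+12}{9}} & \text{if } k\equiv 0 \pmod 3,\\[2pt] C\,(\log_2 n)^{\frac{2k-2}{3}}\; t^{\frac{k-1}{3}}\; n^{\frac{4k+8}{9}} & \text{if } k\equiv 1 \pmod 3,\\[2pt] C\,(\log_2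 n)^{\frac{2k+2}{3}}\; t^{\frac{k+1}{3}}\; n^{\frac{4k+4}{9}} & \text{if } k\equiv 2 \pmod 3. \end{cases} $$ -/

import Mathlib

/-- The Euclidean plane. -/
abbrev Plane : Type := EuclideanSpace ℝ (Fin 2)

open Classical in
/-- The dot product `k`-chains of type `α = (α₁, …, α_k)` in `E`: all `(k+1)`-tuples
`(R₁, …, R_{k+1})` of points of `E` with `R_j ⬝ R_{j+1} = α_j` for `j = 1, …, k`.
Points may be repeated in a tuple. -/
noncomputable def dotChains {k : ℕ} (E : Finset Plane) (α : Fin k → ℝ) :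
    Finset (Fin (k + 1) → Plane) :=
  (Fintype.piFinset fun _ => E).filter
    fun R => ∀ j : Fin k, inner ℝ (R j.castSucc) (R j.succ) = α j

open Classical in
/-- No line of the plane contains more than `t` points of `E`. -/
def AtMostOnLines (E : Finset Plane) (t : ℕ) : Prop :=
  ∀ L : AffineSubspace ℝ Plane, Module.finrank ℝ L.direction = 1 →
    (E.filter fun P => P ∈ L).card ≤ t

/-! A nonzero dot product occurs `O(n ^ (4 / 3))` times in `E` (`card_dot_pairs_le`): `p ⬝ q = a`
says that `q` lies on a line determined by `p`, so Szemerédi–Trotter applies. Chains are then built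
greedily. Two new points cost `B = 11 n ^ (4 / 3)`, the condition linking them to the old chain
being dropped; one new point costs `t`, since it lies on a known line. Starting from `B` for one
link, each three further links cost `t * B`, and one or two leftover links cost `t` or `B`. These
are the claimed powers of `t` and `n`; the logarithm only weakens the bound.

Szemerédi–Trotter comes from a crossing lemma for straight segments: non-crossing families are
linear in size (`card_le_of_not_segCross`), deleting one segment per crossing handles the rest, and
averaging over random subsets of the points amplifies this (`card_mul_sq_le`). -/

/-! ### Non-crossing segments -/

/-- The value at `x` of the affine function whose graph is the line `l`, given by its slope and
its intercept. -/
def lineHeight (l : ℝ × ℝ) (x : ℝ) : ℝ := l.1 * x + l.2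

/-- The segments `e` and `e'` cross, `e` passing from below `e'` to above it. A segment is given by
its left endpoint and its line; `r` assigns to each segment its right endpoint. -/
def SegCross (r : (ℝ × ℝ) × (ℝ × ℝ) → ℝ × ℝ) (e e' : (ℝ × ℝ) × (ℝ × ℝ)) : Prop :=
  ∃ x y, x < y ∧ e.1.1 ≤ x ∧ e'.1.1 ≤ x ∧ y ≤ (r e).1 ∧ y ≤ (r e').1 ∧
    lineHeight e.2 x < lineHeight e'.2 x ∧ lineHeight e'.2 y < lineHeight e.2 y

/-- `r` makes `e` a non-vertical segment with both endpoints in `S`. -/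
structure IsSegIn (S : Finset (ℝ × ℝ)) (r : (ℝ × ℝ) × (ℝ × ℝ) → ℝ × ℝ)
    (e : (ℝ × ℝ) × (ℝ × ℝ)) : Prop where
  left_mem : e.1 ∈ S
  right_mem : r e ∈ S
  lt : e.1.1 < (r e).1
  left_on : e.1.2 = lineHeight e.2 e.1.1
  right_on : (r e).2 = lineHeight e.2 (r e).1

/-- `w` is a leftmost point of `S` in the wedge between the segments `e` and `f`, which share their
left endpoint. -/
structure IsFirstInWedge (S : Finset (ℝ × ℝ)) (r : (ℝ × ℝ) × (ℝ × ℝ) → ℝ × ℝ)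
    (e f : (ℝ × ℝ) × (ℝ × ℝ)) (w : ℝ × ℝ) : Prop where
  lt : e.1.1 < w.1
  le_lower : w.1 ≤ (r e).1
  le_upper : w.1 ≤ (r f).1
  lower_le : lineHeight e.2 w.1 ≤ w.2
  le_upper_height : w.2 ≤ lineHeight f.2 w.1
  first : ∀ z ∈ S, e.1.1 < z.1 → z.1 < w.1 → lineHeight e.2 z.1 ≤ z.2 →
    ¬ z.2 ≤ lineHeight f.2 z.1

section Planar

variable {S : Finset (ℝ × ℝ)} {r : (ℝ × ℝ) × (ℝ × ℝ) → ℝ × ℝ}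

/-- The right endpoint of the shorter segment already lies in the wedge. -/
lemma exists_isFirstInWedge {e f : (ℝ × ℝ) × (ℝ × ℝ)} (he : IsSegIn S r e) (hf : IsSegIn S r f)
    (hef : e.1 = f.1) (hs : e.2.1 < f.2.1) :
    ∃ w ∈ S, IsFirstInWedge S r e f w := by
  classical
  have key : ∀ x, e.1.1 < x → lineHeight e.2 x < lineHeight f.2 x := by
    intro x hx
    have h1 := he.left_on
    have h2 := hf.left_on
    rw [← hef] at h2
    simp only [lineHeight] at *
    nlinarith
  set T := S.filter fun w => e.1.1 < w.1 ∧ w.1 ≤ (r e).1 ∧ w.1 ≤ (r f).1 ∧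
    lineHeight e.2 w.1 ≤ w.2 ∧ w.2 ≤ lineHeight f.2 w.1 with hT
  have hne : T.Nonempty := by
    rcases le_total (r e).1 (r f).1 with h | h
    · exact ⟨r e, by simp only [hT, Finset.mem_filter]
                     exact ⟨he.right_mem, he.lt, le_rfl, h, he.right_on.ge,
                       he.right_on.le.trans (key _ he.lt).le⟩⟩
    · have hlt : e.1.1 < (r f).1 := hef ▸ hf.lt
      exact ⟨r f, by simp only [hT, Finset.mem_filter]
                     exact ⟨hf.right_mem, hlt, h, le_rfl,
                       (key _ hlt).le.trans hf.right_on.ge, hf.right_on.le⟩⟩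
  obtain ⟨w, hw, hmin⟩ := T.exists_min_image (fun w => w.1) hne
  obtain ⟨hwS, h1, h2, h3, h4, h5⟩ := Finset.mem_filter.1 hw
  refine ⟨w, hwS, h1, h2, h3, h4, h5, fun z hz a b c d => ?_⟩
  exact absurd (hmin z (Finset.mem_filter.2
    ⟨hz, a, b.le.trans h2, b.le.trans h3, c, d⟩)) (not_le.2 b)

/-- Going left from `w`, non-crossing keeps the order of `f₁`, `e₂` and of `e₁`, `f₂`. So the apex
of the second wedge lies in the first, before `w`; by minimality of `w` this forces equal abscissae,
where the first wedge is a single point. -/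
lemma IsFirstInWedge.left_eq_of_le {e₁ f₁ e₂ f₂ : (ℝ × ℝ) × (ℝ × ℝ)} {w : ℝ × ℝ}
    (h₁ : IsFirstInWedge S r e₁ f₁ w) (h₂ : IsFirstInWedge S r e₂ f₂ w)
    (he₁ : IsSegIn S r e₁) (hf₁ : IsSegIn S r f₁) (he₂ : IsSegIn S r e₂) (hf₂ : IsSegIn S r f₂)
    (hef₁ : e₁.1 = f₁.1) (hef₂ : e₂.1 = f₂.1)
    (hc₁ : ¬ SegCross r f₁ e₂) (hc₂ : ¬ SegCross r f₂ e₁)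
    (hlt₁ : lineHeight e₂.2 w.1 < lineHeight f₁.2 w.1)
    (hlt₂ : lineHeight e₁.2 w.1 < lineHeight f₂.2 w.1)
    (hle : e₁.1.1 ≤ e₂.1.1) : e₁.1 = e₂.1 := by
  have hA : e₂.1.2 ≤ lineHeight f₁.2 e₂.1.1 := by
    by_contra! hcon
    exact hc₁ ⟨e₂.1.1, w.1, h₂.lt, hef₁ ▸ hle, le_rfl, h₁.le_upper, h₂.le_lower,
      he₂.left_on ▸ hcon, hlt₁⟩
  have hB : lineHeight e₁.2 e₂.1.1 ≤ e₂.1.2 := by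
    by_contra! hcon
    refine hc₂ ⟨e₂.1.1, w.1, h₂.lt, hef₂ ▸ le_rfl, hle, h₂.le_upper, h₁.le_lower, ?_, hlt₂⟩
    have := hf₂.left_on
    rw [← hef₂] at this
    rwa [← this]
  rcases hle.lt_or_eq with h | h
  · exact absurd hA (h₁.first _ he₂.left_mem h h₂.lt hB)
  · refine Prod.ext h ?_
    have a := he₁.left_on
    have b := hf₁.left_on
    rw [← hef₁] at b
    rw [← h] at hA hB
    linarith

lemma IsFirstInWedge.left_eq {e₁ f₁ e₂ f₂ : (ℝ × ℝ) × (ℝ × ℝ)} {w : ℝ × ℝ}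
    (h₁ : IsFirstInWedge S r e₁ f₁ w) (h₂ : IsFirstInWedge S r e₂ f₂ w)
    (he₁ : IsSegIn S r e₁) (hf₁ : IsSegIn S r f₁) (he₂ : IsSegIn S r e₂) (hf₂ : IsSegIn S r f₂)
    (hef₁ : e₁.1 = f₁.1) (hef₂ : e₂.1 = f₂.1)
    (hc₁ : ¬ SegCross r f₁ e₂) (hc₂ : ¬ SegCross r f₂ e₁)
    (hlt₁ : lineHeight e₂.2 w.1 < lineHeight f₁.2 w.1)
    (hlt₂ : lineHeight e₁.2 w.1 < lineHeight f₂.2 w.1) : e₁.1 = e₂.1 := by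
  rcases le_total e₁.1.1 e₂.1.1 with h | h
  · exact h₁.left_eq_of_le h₂ he₁ hf₁ he₂ hf₂ hef₁ hef₂ hc₁ hc₂ hlt₁ hlt₂ h
  · exact (h₂.left_eq_of_le h₁ he₂ hf₂ he₁ hf₁ hef₂ hef₁ hc₂ hc₁ hlt₂ hlt₁ h).symm

lemma IsSegIn.eq_of_left_eq_of_slope_eq {e f : (ℝ × ℝ) × (ℝ × ℝ)} (he : IsSegIn S r e)
    (hf : IsSegIn S r f) (hef : e.1 = f.1) (hs : e.2.1 = f.2.1) : e = f := by
  have h1 := he.left_on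
  have h2 := hf.left_on
  rw [← hef] at h2
  simp only [lineHeight] at h1 h2
  rw [← hs] at h2
  exact Prod.ext hef (Prod.ext hs (by linarith))

/-- `f` is the segment of `F` that follows `e` in the order of slopes at its left endpoint. -/
structure IsNextSlope (F : Finset ((ℝ × ℝ) × (ℝ × ℝ))) (e f : (ℝ × ℝ) × (ℝ × ℝ)) : Prop where
  mem : f ∈ F
  left_eq : e.1 = f.1
  lt : e.2.1 < f.2.1
  le : ∀ g ∈ F, e.1 = g.1 → e.2.1 < g.2.1 → f.2.1 ≤ g.2.1

lemma exists_isNextSlope {F : Finset ((ℝ × ℝ) × (ℝ × ℝ))} {e : (ℝ × ℝ) × (ℝ × ℝ)}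
    (h : ∃ g ∈ F, e.1 = g.1 ∧ e.2.1 < g.2.1) : ∃ f, IsNextSlope F e f := by
  classical
  obtain ⟨g, hg, h1, h2⟩ := h
  obtain ⟨f, hf, hmin⟩ := (F.filter fun g => e.1 = g.1 ∧ e.2.1 < g.2.1).exists_min_image
    (fun g => g.2.1) ⟨g, Finset.mem_filter.2 ⟨hg, h1, h2⟩⟩
  obtain ⟨a, b, c⟩ := Finset.mem_filter.1 hf
  exact ⟨f, a, b, c, fun g hg h1 h2 => hmin g (Finset.mem_filter.2 ⟨hg, h1, h2⟩)⟩

/-- A family of pairwise non-crossing segments with endpoints in `S` has at most `4 |S|` members. -/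
theorem card_le_of_not_segCross {F : Finset ((ℝ × ℝ) × (ℝ × ℝ))}
    (hF : ∀ e ∈ F, IsSegIn S r e) (hc : ∀ e ∈ F, ∀ e' ∈ F, ¬ SegCross r e e') :
    F.card ≤ 4 * S.card := by
  classical
  set Q : (ℝ × ℝ) × (ℝ × ℝ) → Prop := fun e => ∃ g ∈ F, e.1 = g.1 ∧ e.2.1 < g.2.1 with hQ
  -- Only the steepest segment at each left endpoint has no successor.
  have htop : (F.filter fun e => ¬ Q e).card ≤ S.card := by
    refine Finset.card_le_card_of_injOn Prod.fst ?_ ?_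
    · intro e he
      exact (hF e (Finset.mem_filter.1 he).1).left_mem
    · intro e he f hf hef
      obtain ⟨he, hqe⟩ := Finset.mem_filter.1 he
      obtain ⟨hf, hqf⟩ := Finset.mem_filter.1 hf
      refine (hF e he).eq_of_left_eq_of_slope_eq (hF f hf) hef (le_antisymm ?_ ?_)
      · by_contra! h
        exact hqf ⟨e, he, hef.symm, h⟩
      · by_contra! h
        exact hqe ⟨f, hf, hef, h⟩
  have hdata : ∀ e, e ∈ F → Q e → ∃ f w, IsNextSlope F e f ∧ w ∈ S ∧ IsFirstInWedge S r e f w := by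
    intro e he hq
    obtain ⟨f, hf⟩ := exists_isNextSlope hq
    obtain ⟨w, hw, h⟩ := exists_isFirstInWedge (hF e he) (hF f hf.mem) hf.left_eq hf.lt
    exact ⟨f, w, hf, hw, h⟩
  choose! f w hf hw hfw using hdata
  -- Whether `w` is on the lower side, on the upper side or strictly inside. Equal tags give the
  -- strict inequalities at `w` that `left_eq` needs. Three tags and the steepest segments account
  -- for the constant 4.
  set tag : (ℝ × ℝ) × (ℝ × ℝ) → Fin 3 := fun e =>
    if lineHeight e.2 (w e).1 = (w e).2 then 0
    else if (w e).2 = lineHeight (f e).2 (w e).1 then 1 else 2 with htag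
  have hrest : (F.filter Q).card ≤ (S ×ˢ (Finset.univ : Finset (Fin 3))).card := by
    refine Finset.card_le_card_of_injOn (fun e => (w e, tag e)) ?_ ?_
    · intro e he
      obtain ⟨he, hq⟩ := Finset.mem_filter.1 he
      simpa using hw e he hq
    · intro e₁ he₁ e₂ he₂ heq
      obtain ⟨he₁, hq₁⟩ := Finset.mem_filter.1 he₁
      obtain ⟨he₂, hq₂⟩ := Finset.mem_filter.1 he₂
      obtain ⟨hww, htt⟩ := Prod.mk.inj heq
      have H₁ := hfw e₁ he₁ hq₁
      have H₂ := hfw e₂ he₂ hq₂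
      have N₁ := hf e₁ he₁ hq₁
      have N₂ := hf e₂ he₂ hq₂
      have gap : ∀ e ∈ F, Q e → lineHeight e.2 (w e).1 < lineHeight (f e).2 (w e).1 := by
        intro e he hq
        have h1 := (hF e he).left_on
        have h2 := (hF _ (hf e he hq).mem).left_on
        rw [← (hf e he hq).left_eq] at h2
        have h3 := (hf e he hq).lt
        have h4 := (hfw e he hq).lt
        simp only [lineHeight] at *
        nlinarith
      have G₁ := gap e₁ he₁ hq₁
      have G₂ := gap e₂ he₂ hq₂
      simp only [htag] at htt
      rw [← hww] at H₂ htt G₂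
      have a₁ := H₁.lower_le
      have a₂ := H₂.lower_le
      have b₁ := H₁.le_upper_height
      have b₂ := H₂.le_upper_height
      have hlt : lineHeight e₂.2 (w e₁).1 < lineHeight (f e₁).2 (w e₁).1 ∧
          lineHeight e₁.2 (w e₁).1 < lineHeight (f e₂).2 (w e₁).1 := by
        split_ifs at htt with c1 c2 c3 c4 c5 c6 c7 c8
        all_goals first
          | exact absurd htt (by decide)
          | (constructor <;> grind)
      have hleft := H₁.left_eq H₂ (hF _ he₁) (hF _ N₁.mem) (hF _ he₂) (hF _ N₂.mem)
        N₁.left_eq N₂.left_eq (hc _ N₁.mem _ he₂) (hc _ N₂.mem _ he₁) hlt.1 hlt.2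
      -- A segment at the same apex steeper than `e` is at least as steep as the successor `g`,
      -- hence not below `g` at `w`.
      have habs : ∀ e ∈ F, ∀ e' ∈ F, ∀ g, e.1 = e'.1 → e.1.1 < (w e₁).1 → IsNextSlope F e g →
          lineHeight e'.2 (w e₁).1 < lineHeight g.2 (w e₁).1 → e'.2.1 ≤ e.2.1 := by
        intro e he e' he' g hee hx hg hl
        by_contra! hcon
        have h0 := hg.le e' he' hee hcon
        have h1 := (hF e' he').left_on
        have h2 := (hF g hg.mem).left_on
        rw [← hg.left_eq] at h2
        rw [← hee] at h1
        simp only [lineHeight] at *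
        nlinarith
      refine (hF _ he₁).eq_of_left_eq_of_slope_eq (hF _ he₂) hleft (le_antisymm ?_ ?_)
      · exact habs e₂ he₂ e₁ he₁ _ hleft.symm H₂.lt N₂ hlt.2
      · exact habs e₁ he₁ e₂ he₂ _ hleft H₁.lt N₁ hlt.1
  have hsum := Finset.card_filter_add_card_filter_not (s := F) Q
  rw [Finset.card_product, Finset.card_univ, Fintype.card_fin] at hrest
  omega

open Classical in
/-- A family of segments with endpoints in `S` and with `X` crossings has at most `4 |S| + X`
members. -/
theorem card_le_add_card_segCross {F : Finset ((ℝ × ℝ) × (ℝ × ℝ))}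
    (hF : ∀ e ∈ F, IsSegIn S r e) :
    F.card ≤ 4 * S.card + ((F ×ˢ F).filter fun z => SegCross r z.1 z.2).card := by
  set X := (F ×ˢ F).filter fun z => SegCross r z.1 z.2 with hX
  -- Deleting the first member of every crossing pair leaves no crossing.
  have h1 : (F \ X.image Prod.fst).card ≤ 4 * S.card := by
    refine card_le_of_not_segCross (r := r) (fun e he => hF e (Finset.mem_sdiff.1 he).1) ?_
    intro e he e' he' hcr
    refine (Finset.mem_sdiff.1 he).2 (Finset.mem_image.2 ⟨(e, e'), ?_, rfl⟩)
    rw [hX, Finset.mem_filter, Finset.mem_product]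
    exact ⟨⟨(Finset.mem_sdiff.1 he).1, (Finset.mem_sdiff.1 he').1⟩, hcr⟩
  have h2 : (X.image Prod.fst).card ≤ X.card := Finset.card_image_le
  have h3 := Finset.le_card_sdiff (X.image Prod.fst) F
  omega

end Planar

/-! ### Random sampling of points by counting colourings -/

section Sampling

open Classical in
/-- The points of `S` that receive the colour `0`. -/
noncomputable def zeroClass {S : Finset (ℝ × ℝ)} {M : ℕ} [NeZero M] (c : S → Fin M) :
    Finset (ℝ × ℝ) :=
  S.filter fun p => ∀ h : p ∈ S, c ⟨p, h⟩ = 0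

variable {S : Finset (ℝ × ℝ)} {M : ℕ} [NeZero M]

-- A uniform colouring gives colour `0` to all of `U` with probability `M ^ (-|U|)`; denominators
-- are cleared.
open Classical in
lemma card_colorings_mul_pow {U : Finset (ℝ × ℝ)} (hU : U ⊆ S) :
    (Finset.univ.filter fun c : S → Fin M => U ⊆ zeroClass c).card * M ^ U.card =
      M ^ S.card := by
  have h1 : (Finset.univ.filter fun c : S → Fin M => U ⊆ zeroClass c) =
      Fintype.piFinset fun x : S => if x.1 ∈ U then {0} else Finset.univ := by
    ext c
    simp only [Finset.mem_filter, Finset.mem_univ, true_and, Fintype.mem_piFinset]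
    constructor
    · intro h x
      split_ifs with hx
      · simpa using (Finset.mem_filter.1 (h hx)).2 x.2
      · exact Finset.mem_univ _
    · intro h x hx
      refine Finset.mem_filter.2 ⟨hU hx, fun hxS => ?_⟩
      simpa [hx] using h ⟨x, hxS⟩
  have h2 : ∀ x : S, (if x.1 ∈ U then ({0} : Finset (Fin M)) else Finset.univ).card =
      if x.1 ∈ U then 1 else M := by
    intro x
    split_ifs <;> simp
  rw [h1, Fintype.card_piFinset, Finset.prod_congr rfl fun x _ => h2 x,
    Finset.prod_coe_sort S fun x => if x ∈ U then 1 else M]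
  have h3 : M ^ U.card = ∏ x ∈ S, if x ∈ U then M else 1 := by
    rw [Finset.prod_ite_mem, Finset.inter_eq_right.2 hU, Finset.prod_const]
  rw [h3, ← Finset.prod_mul_distrib, ← Finset.prod_const]
  refine Finset.prod_congr rfl fun x _ => ?_
  split_ifs <;> simp

-- Linearity of expectation, as a double count of pairs of a colouring and a surviving object.
open Classical in
lemma sum_card_filter_mul_pow {β : Type*} (A : Finset β) (U : β → Finset (ℝ × ℝ)) (j : ℕ)
    (hU : ∀ a ∈ A, U a ⊆ S) (hj : ∀ a ∈ A, (U a).card = j) :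
    (∑ c : S → Fin M, (A.filter fun a => U a ⊆ zeroClass c).card) * M ^ j =
      A.card * M ^ S.card := by
  have h := Finset.sum_card_bipartiteAbove_eq_sum_card_bipartiteBelow
    (s := (Finset.univ : Finset (S → Fin M))) (t := A) fun c a => U a ⊆ zeroClass c
  simp only [Finset.bipartiteAbove, Finset.bipartiteBelow] at h
  rw [h, Finset.sum_mul, Finset.sum_congr rfl (g := fun _ => M ^ S.card)]
  · simp
  · intro a ha
    rw [← hj a ha, card_colorings_mul_pow (hU a ha)]

end Sampling

/-! ### The crossing lemma -/

section Crossing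

variable {S : Finset (ℝ × ℝ)} {r : (ℝ × ℝ) × (ℝ × ℝ) → ℝ × ℝ}

/-- Two distinct lines meet at most once, so segments sharing an endpoint cannot cross. Hence a
crossing survives sampling with probability exactly `M ^ (-4)`. -/
lemma SegCross.card_endpoints {e e' : (ℝ × ℝ) × (ℝ × ℝ)} (h : SegCross r e e')
    (he : IsSegIn S r e) (he' : IsSegIn S r e') :
    ({e.1, r e, e'.1, r e'} : Finset (ℝ × ℝ)).card = 4 := by
  obtain ⟨x, y, hxy, h1, h2, h3, h4, h5, h6⟩ := h
  have a1 := he.left_on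
  have a2 := he.right_on
  have b1 := he'.left_on
  have b2 := he'.right_on
  have l1 := he.lt
  have l2 := he'.lt
  have n1 : e.1 ≠ r e := fun h => by rw [← h] at l1; exact lt_irrefl _ l1
  have n2 : e'.1 ≠ r e' := fun h => by rw [← h] at l2; exact lt_irrefl _ l2
  have n3 : e.1 ≠ r e' := fun h => by rw [← h] at h4; linarith
  have n4 : r e ≠ e'.1 := fun h => by rw [h] at h3; linarith
  have n5 : e.1 ≠ e'.1 := by
    intro h
    rw [← h] at b1
    simp only [lineHeight] at *
    have c1 : (e.2.1 - e'.2.1) * (x - e.1.1) < 0 := by linarith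
    have c2 : 0 < (e.2.1 - e'.2.1) * (y - x) := by linarith
    have c3 : 0 < e.2.1 - e'.2.1 := pos_of_mul_pos_left c2 (by linarith)
    nlinarith
  have n6 : r e ≠ r e' := by
    intro h
    rw [← h] at b2 h4
    simp only [lineHeight] at *
    have c1 : (e.2.1 - e'.2.1) * ((r e).1 - y) < 0 := by linarith
    have c2 : 0 < (e.2.1 - e'.2.1) * (y - x) := by linarith
    have c3 : 0 < e.2.1 - e'.2.1 := pos_of_mul_pos_left c2 (by linarith)
    nlinarith
  rw [Finset.card_insert_of_notMem, Finset.card_insert_of_notMem, Finset.card_pair n2]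
  · simp [n4, n6]
  · simp [n1, n3, n5]

open Classical in
/-- The crossing lemma for straight segments, before optimising the sampling rate `1 / M`. -/
theorem card_mul_sq_le {F : Finset ((ℝ × ℝ) × (ℝ × ℝ))} (hF : ∀ e ∈ F, IsSegIn S r e)
    {M : ℕ} (hM : M ≠ 0) :
    F.card * M ^ 2 ≤
      4 * S.card * M ^ 3 + ((F ×ˢ F).filter fun z => SegCross r z.1 z.2).card := by
  have : NeZero M := ⟨hM⟩
  set X := (F ×ˢ F).filter fun z => SegCross r z.1 z.2 with hX
  set V : (ℝ × ℝ) × (ℝ × ℝ) → Finset (ℝ × ℝ) := fun e => {e.1, r e} with hV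
  set W : ((ℝ × ℝ) × (ℝ × ℝ)) × ((ℝ × ℝ) × (ℝ × ℝ)) → Finset (ℝ × ℝ) :=
    fun z => {z.1.1, r z.1, z.2.1, r z.2} with hW
  have e2 := sum_card_filter_mul_pow (S := S) (M := M) F V 2
    (fun e he => by
      simp only [hV, Finset.insert_subset_iff, Finset.singleton_subset_iff]
      exact ⟨(hF e he).left_mem, (hF e he).right_mem⟩)
    (fun e he => Finset.card_pair fun h => by
      have := (hF e he).lt
      rw [← h] at this
      exact lt_irrefl _ this)
  have e1 := sum_card_filter_mul_pow (S := S) (M := M) S (fun p => {p}) 1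
    (fun p hp => by simpa using hp) (fun p _ => by simp)
  have e4 := sum_card_filter_mul_pow (S := S) (M := M) X W 4
    (fun z hz => by
      obtain ⟨hz, -⟩ := Finset.mem_filter.1 hz
      obtain ⟨h1, h2⟩ := Finset.mem_product.1 hz
      simp only [hW, Finset.insert_subset_iff, Finset.singleton_subset_iff]
      exact ⟨(hF _ h1).left_mem, (hF _ h1).right_mem, (hF _ h2).left_mem, (hF _ h2).right_mem⟩)
    (fun z hz => by
      obtain ⟨hz, hcr⟩ := Finset.mem_filter.1 hz
      obtain ⟨h1, h2⟩ := Finset.mem_product.1 hz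
      exact hcr.card_endpoints (hF _ h1) (hF _ h2))
  have hle : ∀ c : S → Fin M, (F.filter fun e => V e ⊆ zeroClass c).card ≤
      4 * (S.filter fun p => {p} ⊆ zeroClass c).card +
        (X.filter fun z => W z ⊆ zeroClass c).card := by
    intro c
    have h := card_le_add_card_segCross (S := zeroClass c) (r := r)
      (F := F.filter fun e => V e ⊆ zeroClass c) (fun e he => by
        obtain ⟨he, hs⟩ := Finset.mem_filter.1 he
        simp only [hV, Finset.insert_subset_iff, Finset.singleton_subset_iff] at hs
        exact ⟨hs.1, hs.2, (hF e he).lt, (hF e he).left_on, (hF e he).right_on⟩)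
    refine h.trans (add_le_add (Nat.mul_le_mul_left _ (Finset.card_le_card ?_))
      (Finset.card_le_card ?_))
    · intro p hp
      exact Finset.mem_filter.2 ⟨(Finset.mem_filter.1 hp).1, by simpa using hp⟩
    · intro z hz
      simp only [Finset.mem_filter, Finset.mem_product, hV, Finset.insert_subset_iff,
        Finset.singleton_subset_iff] at hz
      simp only [hX, hW, Finset.mem_filter, Finset.mem_product, Finset.insert_subset_iff,
        Finset.singleton_subset_iff]
      tauto
  -- In expectation: `|F| / M ^ 2 ≤ 4 |S| / M + |X| / M ^ 4`.
  have hsum := Finset.sum_le_sum fun c (_ : c ∈ (Finset.univ : Finset (S → Fin M))) => hle c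
  rw [Finset.sum_add_distrib, ← Finset.mul_sum] at hsum
  set s2 := ∑ c : S → Fin M, (F.filter fun e => V e ⊆ zeroClass c).card
  set s1 := ∑ c : S → Fin M, (S.filter fun p => {p} ⊆ zeroClass c).card
  set s4 := ∑ c : S → Fin M, (X.filter fun z => W z ⊆ zeroClass c).card
  have hpos : 0 < M ^ S.card := pow_pos (Nat.pos_of_ne_zero hM) _
  refine Nat.le_of_mul_le_mul_right ?_ hpos
  calc F.card * M ^ 2 * M ^ S.card = (F.card * M ^ S.card) * M ^ 2 := by ring
    _ = s2 * M ^ 4 := by rw [← e2]; ring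
    _ ≤ (4 * s1 + s4) * M ^ 4 := Nat.mul_le_mul_right _ hsum
    _ = 4 * (s1 * M ^ 1) * M ^ 3 + s4 * M ^ 4 := by ring
    _ = (4 * S.card * M ^ 3 + X.card) * M ^ S.card := by rw [e1, e4]; ring

end Crossing

/-! ### The Szemerédi–Trotter bound -/

section Incidences

variable {S L : Finset (ℝ × ℝ)}

/-- `q` is the first point of `S` to the right of `e.1` on the line `e.2`. -/
structure IsNextOnLine (S : Finset (ℝ × ℝ)) (e : (ℝ × ℝ) × (ℝ × ℝ)) (q : ℝ × ℝ) : Prop where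
  mem : q ∈ S
  on : q.2 = lineHeight e.2 q.1
  lt : e.1.1 < q.1
  le : ∀ z ∈ S, z.2 = lineHeight e.2 z.1 → e.1.1 < z.1 → q.1 ≤ z.1

open Classical in
/-- The incidences between the points `S` and the non-vertical lines `L`. -/
noncomputable def incidences (S L : Finset (ℝ × ℝ)) : Finset ((ℝ × ℝ) × (ℝ × ℝ)) :=
  (S ×ˢ L).filter fun e => e.1.2 = lineHeight e.2 e.1.1

/-- Once one line has passed above another it stays above, so the same upward crossing cannot recur
further right. -/
lemma SegCross.not_stacked {r : (ℝ × ℝ) × (ℝ × ℝ) → ℝ × ℝ} {e e' f f' : (ℝ × ℝ) × (ℝ × ℝ)}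
    (h : SegCross r e e') (h' : SegCross r f f') (h1 : e.2 = f.2) (h2 : e'.2 = f'.2) :
    ¬ ((r e).1 ≤ f.1.1 ∨ (r e').1 ≤ f'.1.1) := by
  obtain ⟨x, y, hxy, -, -, a1, a2, a3, a4⟩ := h
  obtain ⟨z, w, hzw, b1, b2, -, -, b3, b4⟩ := h'
  rw [← h1, ← h2] at b3 b4
  intro hcon
  have hyz : y ≤ z := by rcases hcon with h | h <;> linarith
  simp only [lineHeight] at *
  have c2 : 0 < (e.2.1 - e'.2.1) * (y - x) := by linarith
  have c3 : 0 < e.2.1 - e'.2.1 := pos_of_mul_pos_left c2 (by linarith)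
  nlinarith

open Classical in
/-- A form of the Szemerédi–Trotter bound, with the sampling rate `1 / M` left free. -/
theorem card_incidences_mul_sq_le {M : ℕ} (hM : M ≠ 0) :
    (incidences S L).card * M ^ 2 ≤ 4 * S.card * M ^ 3 + L.card ^ 2 + L.card * M ^ 2 := by
  -- Incidences with a next point on their line become segments; each line loses at most one, its
  -- last.
  set Q : (ℝ × ℝ) × (ℝ × ℝ) → Prop := fun e =>
    ∃ q ∈ S, q.2 = lineHeight e.2 q.1 ∧ e.1.1 < q.1 with hQ
  have hlast : ((incidences S L).filter fun e => ¬ Q e).card ≤ L.card := by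
    refine Finset.card_le_card_of_injOn Prod.snd ?_ ?_
    · intro e he
      simp only [incidences, Finset.coe_filter, Finset.mem_filter, Finset.mem_product] at he
      exact he.1.1.2
    · intro e he f hf hef
      simp only [incidences, Finset.coe_filter, Finset.mem_filter, Finset.mem_product] at he hf
      obtain ⟨⟨⟨he1, -⟩, he2⟩, he3⟩ := he
      obtain ⟨⟨⟨hf1, -⟩, hf2⟩, hf3⟩ := hf
      have hx : e.1.1 = f.1.1 := by
        refine le_antisymm ?_ ?_
        · by_contra! h
          exact hf3 ⟨e.1, he1, hef ▸ he2, h⟩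
        · by_contra! h
          exact he3 ⟨f.1, hf1, hef ▸ hf2, h⟩
      refine Prod.ext (Prod.ext hx ?_) hef
      rw [he2, hf2, hx, hef]
  have hnext : ∀ e, Q e → ∃ q, IsNextOnLine S e q := by
    rintro e ⟨q, h1, h2, h3⟩
    obtain ⟨w, hw, hmin⟩ := (S.filter fun q => q.2 = lineHeight e.2 q.1 ∧
      e.1.1 < q.1).exists_min_image (fun q => q.1) ⟨q, Finset.mem_filter.2 ⟨h1, h2, h3⟩⟩
    obtain ⟨a, b, c⟩ := Finset.mem_filter.1 hw
    exact ⟨w, a, b, c, fun z hz h1 h2 => hmin z (Finset.mem_filter.2 ⟨hz, h1, h2⟩)⟩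
  choose! r hr using hnext
  set F := (incidences S L).filter Q with hF
  have hmem : ∀ e ∈ F, e.1 ∈ S ∧ e.2 ∈ L ∧ e.1.2 = lineHeight e.2 e.1.1 ∧ Q e := by
    intro e he
    simp only [hF, incidences, Finset.mem_filter, Finset.mem_product] at he
    tauto
  have hseg : ∀ e ∈ F, IsSegIn S r e := fun e he => by
    obtain ⟨h1, -, h3, h4⟩ := hmem e he
    exact ⟨h1, (hr e h4).mem, (hr e h4).lt, h3, (hr e h4).on⟩
  have hinj : ∀ e ∈ F, ∀ f ∈ F, e.2 = f.2 → ¬ (r e).1 ≤ f.1.1 → ¬ (r f).1 ≤ e.1.1 → e = f := by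
    intro e he f hf hef h1 h2
    obtain ⟨he1, -, he3, he4⟩ := hmem e he
    obtain ⟨hf1, -, hf3, hf4⟩ := hmem f hf
    have hx : e.1.1 = f.1.1 := by
      refine le_antisymm ?_ ?_
      · by_contra! h
        exact h2 ((hr f hf4).le e.1 he1 (hef ▸ he3) h)
      · by_contra! h
        exact h1 ((hr e he4).le f.1 hf1 (hef ▸ hf3) h)
    refine Prod.ext (Prod.ext hx ?_) hef
    rw [he3, hf3, hx, hef]
  -- An ordered pair of lines carries at most one crossing of segments.
  have hX : ((F ×ˢ F).filter fun z => SegCross r z.1 z.2).card ≤ L.card ^ 2 := by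
    rw [sq, ← Finset.card_product]
    refine Finset.card_le_card_of_injOn (fun z => (z.1.2, z.2.2)) ?_ ?_
    · intro z hz
      obtain ⟨hz, -⟩ := Finset.mem_filter.1 hz
      obtain ⟨h1, h2⟩ := Finset.mem_product.1 hz
      exact Finset.mem_product.2 ⟨(hmem _ h1).2.1, (hmem _ h2).2.1⟩
    · intro z hz z' hz' heq
      obtain ⟨hz, hc⟩ := Finset.mem_filter.1 hz
      obtain ⟨h1, h2⟩ := Finset.mem_product.1 hz
      obtain ⟨hz', hc'⟩ := Finset.mem_filter.1 hz'
      obtain ⟨h1', h2'⟩ := Finset.mem_product.1 hz'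
      obtain ⟨l1, l2⟩ := Prod.mk.inj heq
      have n := not_or.1 (hc.not_stacked hc' l1 l2)
      have n' := not_or.1 (hc'.not_stacked hc l1.symm l2.symm)
      exact Prod.ext (hinj _ h1 _ h1' l1 n.1 n'.1) (hinj _ h2 _ h2' l2 n.2 n'.2)
  have hmain := card_mul_sq_le hseg hM
  have hsplit := Finset.card_filter_add_card_filter_not (s := incidences S L) Q
  rw [← hF] at hsplit
  rw [← hsplit, add_mul]
  have := Nat.mul_le_mul_right (M ^ 2) hlast
  omega

/-- The Szemerédi–Trotter bound for `n` points and at most `n` non-vertical lines. -/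
theorem card_incidences_le (hL : L.card ≤ S.card) :
    ((incidences S L).card : ℝ) ≤ 10 * (S.card : ℝ) ^ (4 / 3 : ℝ) := by
  rcases Nat.eq_zero_or_pos S.card with h0 | hpos
  · have : (incidences S L).card = 0 := by
      rw [Finset.card_eq_zero.1 h0]
      simp [incidences]
    rw [this]
    push_cast
    positivity
  set n : ℝ := (S.card : ℝ) with hn
  have hn1 : 1 ≤ n := by rw [hn]; exact_mod_cast hpos
  set c : ℝ := n ^ (1 / 3 : ℝ) with hc
  have hc1 : 1 ≤ c := Real.one_le_rpow hn1 (by norm_num)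
  have hc3 : c ^ 3 = n := by
    rw [hc, ← Real.rpow_natCast, ← Real.rpow_mul (by linarith)]
    norm_num
  have hc4 : n ^ (4 / 3 : ℝ) = c ^ 4 := by
    rw [hc, ← Real.rpow_natCast, ← Real.rpow_mul (by linarith)]
    norm_num
  -- `M` of order `n ^ (1 / 3)` balances `n * M` against `n ^ 2 / M ^ 2`; the three terms contribute
  -- 8, 1 and 1.
  set M := ⌈c⌉₊ with hMdef
  have hM0 : M ≠ 0 := (Nat.ceil_pos.2 (by linarith)).ne'
  have hM1 : c ≤ M := Nat.le_ceil c
  have hM2 : (M : ℝ) ≤ 2 * c := by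
    have := Nat.ceil_lt_add_one (show 0 ≤ c by linarith)
    linarith
  have h : ((incidences S L).card : ℝ) * M ^ 2 ≤ 4 * n * M ^ 3 + L.card ^ 2 + L.card * M ^ 2 := by
    rw [hn]
    exact_mod_cast card_incidences_mul_sq_le (S := S) (L := L) hM0
  have hLn : (L.card : ℝ) ≤ n := by rw [hn]; exact_mod_cast hL
  rw [hc4]
  have hMsq : c ^ 2 ≤ (M : ℝ) ^ 2 := by gcongr
  have hMpos : 0 < (M : ℝ) ^ 2 := by positivity
  refine le_of_mul_le_mul_right (h.trans ?_) hMpos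
  have t1 : 4 * n * (M : ℝ) ^ 3 ≤ 8 * c ^ 4 * M ^ 2 := by
    rw [← hc3]
    have : (M : ℝ) ^ 2 * M ≤ (M : ℝ) ^ 2 * (2 * c) := by gcongr
    calc 4 * c ^ 3 * (M : ℝ) ^ 3 = 4 * c ^ 3 * ((M : ℝ) ^ 2 * M) := by ring
      _ ≤ 4 * c ^ 3 * ((M : ℝ) ^ 2 * (2 * c)) := by gcongr
      _ = 8 * c ^ 4 * M ^ 2 := by ring
  have t2 : (L.card : ℝ) ^ 2 ≤ c ^ 4 * M ^ 2 := by
    calc (L.card : ℝ) ^ 2 ≤ n ^ 2 := by gcongr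
      _ = c ^ 4 * c ^ 2 := by rw [← hc3]; ring
      _ ≤ c ^ 4 * M ^ 2 := by gcongr
  have t3 : (L.card : ℝ) * M ^ 2 ≤ c ^ 4 * M ^ 2 := by
    have : c ^ 3 * 1 ≤ c ^ 3 * c := by gcongr
    have : (L.card : ℝ) ≤ c ^ 4 := by
      rw [← hc3] at hLn
      calc (L.card : ℝ) ≤ c ^ 3 * 1 := by linarith
        _ ≤ c ^ 3 * c := this
        _ = c ^ 4 := by ring
    gcongr
  linarith

end Incidences

/-! ### Pairs with a given dot product -/

section Pairs

lemma plane_inner_eq (p q : Plane) : inner ℝ p q = p 0 * q 0 + p 1 * q 1 := by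
  simp [PiLp.inner_apply, Fin.sum_univ_two, mul_comm]

lemma plane_ext {p q : Plane} (h0 : p 0 = q 0) (h1 : p 1 = q 1) : p = q := by
  ext i
  fin_cases i
  · exact h0
  · exact h1

open Classical in
/-- A nonzero dot product occurs at most `11 n ^ (4 / 3)` times among `n` points of the plane. -/
theorem card_dot_pairs_le (E : Finset Plane) {a : ℝ} (ha : a ≠ 0) :
    (((E ×ˢ E).filter fun z => inner ℝ z.1 z.2 = a).card : ℝ) ≤
      11 * (E.card : ℝ) ^ (4 / 3 : ℝ) := by
  set co : Plane → ℝ × ℝ := fun q => (q 0, q 1) with hco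
  -- The line of all `q` with `p ⬝ q = a`, when `p 1 ≠ 0`; as `a ≠ 0`, it determines `p`.
  set ln : Plane → ℝ × ℝ := fun p => (-p 0 / p 1, a / p 1) with hln
  have hco_inj : Function.Injective co := fun p q h =>
    plane_ext (Prod.mk.inj h).1 (Prod.mk.inj h).2
  set D := (E ×ˢ E).filter fun z => inner ℝ z.1 z.2 = a with hD
  have hmem : ∀ z ∈ D, z.1 ∈ E ∧ z.2 ∈ E ∧ z.1 0 * z.2 0 + z.1 1 * z.2 1 = a := by
    intro z hz
    obtain ⟨h1, h2⟩ := Finset.mem_filter.1 hz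
    obtain ⟨h3, h4⟩ := Finset.mem_product.1 h1
    exact ⟨h3, h4, plane_inner_eq _ _ ▸ h2⟩
  set L := (E.filter fun p => p 1 ≠ 0).image ln with hL
  -- Vertical lines: `p 0 * q 0 = a ≠ 0`, so `q` determines `p`. This raises the constant from 10 to
  -- 11.
  have hvert : (D.filter fun z => ¬ z.1 1 ≠ 0).card ≤ E.card := by
    refine Finset.card_le_card_of_injOn Prod.snd ?_ ?_
    · intro z hz
      exact (hmem z (Finset.mem_filter.1 hz).1).2.1
    · intro z hz w hw hzw
      obtain ⟨hz, hz0⟩ := Finset.mem_filter.1 hz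
      obtain ⟨hw, hw0⟩ := Finset.mem_filter.1 hw
      have h1 := (hmem z hz).2.2
      have h2 := (hmem w hw).2.2
      rw [not_not] at hz0 hw0
      rw [hz0, zero_mul, add_zero] at h1
      rw [hw0, zero_mul, add_zero, ← hzw] at h2
      have hne : z.2 0 ≠ 0 := fun h => ha (by rw [← h1, h, mul_zero])
      exact Prod.ext (plane_ext (mul_right_cancel₀ hne (h1.trans h2.symm)) (hz0.trans hw0.symm)) hzw
  have hline : (D.filter fun z => z.1 1 ≠ 0).card ≤ (incidences (E.image co) L).card := by
    refine Finset.card_le_card_of_injOn (fun z => (co z.2, ln z.1)) ?_ ?_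
    · intro z hz
      obtain ⟨hz, hz0⟩ := Finset.mem_filter.1 hz
      obtain ⟨h1, h2, h3⟩ := hmem z hz
      refine Finset.mem_filter.2 ⟨Finset.mem_product.2 ⟨Finset.mem_image_of_mem _ h2,
        Finset.mem_image_of_mem _ (Finset.mem_filter.2 ⟨h1, hz0⟩)⟩, ?_⟩
      simp only [hco, hln, lineHeight]
      field_simp
      linarith
    · intro z hz w hw hzw
      obtain ⟨-, hz0⟩ := Finset.mem_filter.1 hz
      obtain ⟨-, hw0⟩ := Finset.mem_filter.1 hw
      obtain ⟨h1, h2⟩ := Prod.mk.inj hzw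
      obtain ⟨h3, h4⟩ := Prod.mk.inj h2
      have h5 : z.1 1 = w.1 1 := by
        rw [div_eq_div_iff hz0 hw0] at h4
        exact (mul_left_cancel₀ ha h4).symm
      refine Prod.ext (plane_ext ?_ h5) (hco_inj h1)
      rw [h5, div_left_inj' hw0] at h3
      exact neg_injective h3
  have hS : (E.image co).card = E.card := Finset.card_image_of_injective _ hco_inj
  have hLS : L.card ≤ (E.image co).card :=
    hS ▸ Finset.card_image_le.trans (Finset.card_filter_le _ _)
  have hinc := card_incidences_le hLS
  rw [hS] at hinc
  have hlow : (E.card : ℝ) ≤ (E.card : ℝ) ^ (4 / 3 : ℝ) := by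
    rcases Nat.eq_zero_or_pos E.card with h | h
    · rw [h, Nat.cast_zero]
      positivity
    · exact Real.self_le_rpow_of_one_le (by exact_mod_cast h) (by norm_num)
  have hsplit := Finset.card_filter_add_card_filter_not (s := D) fun z => z.1 1 ≠ 0
  have htot : (D.card : ℝ) ≤ (incidences (E.image co) L).card + E.card := by
    exact_mod_cast hsplit ▸ add_le_add hline hvert
  linarith

open Classical in
/-- If no line has more than `t` points of `E`, then at most `t` points of `E` have a given
nonzero dot product with a given point. -/
theorem AtMostOnLines.card_dot_eq_le {E : Finset Plane} {t : ℕ} (h : AtMostOnLines E t)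
    (p : Plane) {a : ℝ} (ha : a ≠ 0) : (E.filter fun q => inner ℝ p q = a).card ≤ t := by
  rcases (E.filter fun q => inner ℝ p q = a).eq_empty_or_nonempty with h0 | ⟨q₀, hq₀⟩
  · simp [h0]
  have hq₀ := (Finset.mem_filter.1 hq₀).2
  have hp : p ≠ 0 := fun hp => ha (by rw [← hq₀, hp, inner_zero_left])
  have : Fact (Module.finrank ℝ Plane = 1 + 1) := ⟨by simp⟩
  -- The solutions lie on the line through `q₀` orthogonal to `p`.
  refine le_trans (Finset.card_le_card ?_) (h (AffineSubspace.mk' q₀ (ℝ ∙ p)ᗮ) ?_)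
  · intro q hq
    obtain ⟨hqE, hq⟩ := Finset.mem_filter.1 hq
    refine Finset.mem_filter.2 ⟨hqE, ?_⟩
    rw [AffineSubspace.mem_mk', Submodule.mem_orthogonal_singleton_iff_inner_right, vsub_eq_sub,
      inner_sub_right, hq, hq₀, sub_self]
  · rw [AffineSubspace.direction_mk']
    exact Submodule.finrank_orthogonal_span_singleton hp

end Pairs

/-! ### Building chains -/

section Chains

variable {E : Finset Plane} {k : ℕ}

lemma mem_dotChains {α : Fin k → ℝ} {R : Fin (k + 1) → Plane} :
    R ∈ dotChains E α ↔ (∀ i, R i ∈ E) ∧ ∀ j : Fin k, inner ℝ (R j.castSucc) (R j.succ) = α j := by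
  simp [dotChains, Fintype.mem_piFinset]

lemma init_mem_dotChains {α : Fin (k + 1) → ℝ} {R : Fin (k + 2) → Plane}
    (hR : R ∈ dotChains E α) : Fin.init R ∈ dotChains E (Fin.init α) := by
  rw [mem_dotChains] at *
  exact ⟨fun i => hR.1 _, fun j => hR.2 j.castSucc⟩

lemma last_dot_of_mem_dotChains {α : Fin (k + 1) → ℝ} {R : Fin (k + 2) → Plane}
    (hR : R ∈ dotChains E α) :
    inner ℝ (R (Fin.last k).castSucc) (R (Fin.last (k + 1))) = α (Fin.last k) :=
  (mem_dotChains.1 hR).2 (Fin.last k)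

/-- Extending a chain by one point costs a factor `t`. -/
theorem card_dotChains_succ_le {t : ℕ} (h : AtMostOnLines E t) (α : Fin (k + 1) → ℝ)
    (hα : α (Fin.last k) ≠ 0) :
    (dotChains E α).card ≤ t * (dotChains E (Fin.init α : Fin k → ℝ)).card := by
  classical
  refine Finset.card_le_mul_card_image_of_maps_to (f := Fin.init)
    (fun R hR => init_mem_dotChains hR) t fun R' _ => ?_
  refine le_trans ?_ (h.card_dot_eq_le (R' (Fin.last k)) hα)
  refine Finset.card_le_card_of_injOn (fun R => R (Fin.last (k + 1))) ?_ ?_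
  · intro R hR
    obtain ⟨hR, hR'⟩ := Finset.mem_filter.1 hR
    have hdot := last_dot_of_mem_dotChains hR
    refine Finset.mem_filter.2 ⟨(mem_dotChains.1 hR).1 _, ?_⟩
    rw [← hR']
    exact hdot
  · intro R hR Q hQ hRQ
    obtain ⟨-, hR⟩ := Finset.mem_filter.1 hR
    obtain ⟨-, hQ⟩ := Finset.mem_filter.1 hQ
    rw [← Fin.snoc_init_self R, ← Fin.snoc_init_self Q, hR, hQ]
    exact congrArg _ hRQ

open Classical in
/-- Extending a chain by two points costs at most the number of choices for the new pair. -/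
theorem card_dotChains_add_two_le (α : Fin (k + 2) → ℝ) :
    (dotChains E α).card ≤ (dotChains E (Fin.init (Fin.init α : Fin (k + 1) → ℝ) : Fin k → ℝ)).card *
      ((E ×ˢ E).filter fun z => inner ℝ z.1 z.2 = α (Fin.last (k + 1))).card := by
  rw [← Finset.card_product]
  -- The dot product joining the old chain to the new pair is not used.
  refine Finset.card_le_card_of_injOn (fun R => (Fin.init (Fin.init R : Fin (k + 2) → Plane),
    R (Fin.last (k + 1)).castSucc, R (Fin.last (k + 2)))) ?_ ?_
  · intro R hR
    have hE := (mem_dotChains.1 hR).1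
    exact Finset.mem_product.2 ⟨init_mem_dotChains (init_mem_dotChains hR),
      Finset.mem_filter.2 ⟨Finset.mem_product.2 ⟨hE _, hE _⟩, last_dot_of_mem_dotChains hR⟩⟩
  · intro R _ Q _ hRQ
    obtain ⟨h1, h2⟩ := Prod.mk.inj hRQ
    obtain ⟨h2, h3⟩ := Prod.mk.inj h2
    have h4 : (Fin.init R : Fin (k + 2) → Plane) = Fin.init Q := by
      rw [← Fin.snoc_init_self (Fin.init R : Fin (k + 2) → Plane),
        ← Fin.snoc_init_self (Fin.init Q : Fin (k + 2) → Plane), h1]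
      exact congrArg _ h2
    rw [← Fin.snoc_init_self R, ← Fin.snoc_init_self Q, h4, h3]

open Classical in
lemma card_dotChains_one_le (α : Fin 1 → ℝ) :
    (dotChains E α).card ≤ ((E ×ˢ E).filter fun z => inner ℝ z.1 z.2 = α 0).card := by
  refine Finset.card_le_card_of_injOn (fun R => (R 0, R 1)) ?_ ?_
  · intro R hR
    have hE := (mem_dotChains.1 hR).1
    exact Finset.mem_filter.2 ⟨Finset.mem_product.2 ⟨hE _, hE _⟩, last_dot_of_mem_dotChains hR⟩
  · intro R _ Q _ hRQ
    obtain ⟨h1, h2⟩ := Prod.mk.inj hRQ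
    funext i
    fin_cases i
    · exact h1
    · exact h2

variable {t : ℕ} {B : ℝ}

open Classical in
lemma card_dotChains_add_two_le_mul {c : ℝ}
    (hB : ∀ a : ℝ, a ≠ 0 → (((E ×ˢ E).filter fun z => inner ℝ z.1 z.2 = a).card : ℝ) ≤ B)
    (hc : ∀ α : Fin k → ℝ, (∀ j, α j ≠ 0) → ((dotChains E α).card : ℝ) ≤ c)
    (α : Fin (k + 2) → ℝ) (hα : ∀ j, α j ≠ 0) :
    ((dotChains E α).card : ℝ) ≤ c * B := by
  have h1 : ((dotChains E α).card : ℝ) ≤ _ := Nat.cast_le.2 (card_dotChains_add_two_le α)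
  rw [Nat.cast_mul] at h1
  have h2 := hc (Fin.init (Fin.init α : Fin (k + 1) → ℝ)) fun j => hα _
  exact h1.trans (mul_le_mul h2 (hB _ (hα _)) (Nat.cast_nonneg _) ((Nat.cast_nonneg _).trans h2))

lemma card_dotChains_succ_le_mul {c : ℝ} (h : AtMostOnLines E t)
    (hc : ∀ α : Fin k → ℝ, (∀ j, α j ≠ 0) → ((dotChains E α).card : ℝ) ≤ c)
    (α : Fin (k + 1) → ℝ) (hα : ∀ j, α j ≠ 0) :
    ((dotChains E α).card : ℝ) ≤ t * c := by
  have h1 : ((dotChains E α).card : ℝ) ≤ _ := Nat.cast_le.2 (card_dotChains_succ_le h α (hα _))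
  rw [Nat.cast_mul] at h1
  have h2 := hc (Fin.init α) fun j => hα _
  exact h1.trans (mul_le_mul_of_nonneg_left h2 (Nat.cast_nonneg _))

-- Each induction step adds a free pair (factor `B`) and then one point on a known line (factor
-- `t`).
open Classical in
theorem card_dotChains_le_of_mod_one (h : AtMostOnLines E t)
    (hB : ∀ a : ℝ, a ≠ 0 → (((E ×ˢ E).filter fun z => inner ℝ z.1 z.2 = a).card : ℝ) ≤ B)
    (j : ℕ) : ∀ α : Fin (3 * j + 1) → ℝ, (∀ i, α i ≠ 0) →
      ((dotChains E α).card : ℝ) ≤ (t : ℝ) ^ j * B ^ (j + 1) := by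
  induction j with
  | zero =>
    intro α hα
    have h1 : ((dotChains E α).card : ℝ) ≤ _ := Nat.cast_le.2 (card_dotChains_one_le α)
    simpa using h1.trans (hB _ (hα 0))
  | succ j ih =>
    intro α hα
    have h1 := card_dotChains_succ_le_mul h (card_dotChains_add_two_le_mul hB ih) α hα
    exact h1.trans_eq (by ring)

open Classical in
theorem card_dotChains_le_of_mod_two (h : AtMostOnLines E t)
    (hB : ∀ a : ℝ, a ≠ 0 → (((E ×ˢ E).filter fun z => inner ℝ z.1 z.2 = a).card : ℝ) ≤ B)
    (j : ℕ) (α : Fin (3 * j + 2) → ℝ) (hα : ∀ i, α i ≠ 0) :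
    ((dotChains E α).card : ℝ) ≤ (t : ℝ) ^ (j + 1) * B ^ (j + 1) :=
  (card_dotChains_succ_le_mul h (card_dotChains_le_of_mod_one h hB j) α hα).trans_eq (by ring)

open Classical in
theorem card_dotChains_le_of_mod_zero (h : AtMostOnLines E t)
    (hB : ∀ a : ℝ, a ≠ 0 → (((E ×ˢ E).filter fun z => inner ℝ z.1 z.2 = a).card : ℝ) ≤ B)
    (j : ℕ) (α : Fin (3 * j + 3) → ℝ) (hα : ∀ i, α i ≠ 0) :
    ((dotChains E α).card : ℝ) ≤ (t : ℝ) ^ j * B ^ (j + 2) :=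
  (card_dotChains_add_two_le_mul hB (card_dotChains_le_of_mod_one h hB j) α hα).trans_eq (by ring)

end Chains

/-! ### Matching the exponents -/

/-- A bound by powers of `t` and of `11 n ^ (4 / 3)` survives a nonnegative power of the
logarithm, and a larger constant. -/
lemma le_mul_logb_rpow_mul {n t i m k : ℕ} (hn : 1 < n) (hm : m ≤ k + 1) {c x y z : ℝ}
    (hc : c ≤ (t : ℝ) ^ i * (11 * (n : ℝ) ^ (4 / 3 : ℝ)) ^ m) (hx : 0 ≤ x) (hy : y = i)
    (hz : z = 4 / 3 * m) :
    c ≤ 11 ^ (k + 1) * (Real.logb 2 (n : ℝ) ^ x * (t : ℝ) ^ y * (n : ℝ) ^ z) := by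
  have hlog : 1 ≤ Real.logb 2 (n : ℝ) := by
    rw [Real.le_logb_iff_rpow_le (by norm_num) (by positivity), Real.rpow_one]
    exact_mod_cast hn
  have hlogx := Real.one_le_rpow hlog hx
  rw [hy, hz, Real.rpow_natCast, Real.rpow_mul (Nat.cast_nonneg _), Real.rpow_natCast]
  have h11 : (11 : ℝ) ^ m ≤ 11 ^ (k + 1) := pow_le_pow_right₀ (by norm_num) hm
  calc c ≤ 11 ^ m * (1 * (t : ℝ) ^ i * ((n : ℝ) ^ (4 / 3 : ℝ)) ^ m) :=
        hc.trans_eq (by rw [mul_pow]; ring)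
    _ ≤ _ := by gcongr

theorem mainTheorem4 (k : ℕ) (hk : 1 ≤ k) :
    ∃ (C : ℝ) (N : ℕ), ∀ (n t : ℕ) (E : Finset Plane) (α : Fin k → ℝ),
      N < n → E.card = n → AtMostOnLines E t → (∀ j, α j ≠ 0) →
        (k ≡ 0 [MOD 3] →
          ((dotChains E α).card : ℝ) ≤
            C * (Real.logb 2 (n : ℝ) ^ ((2 * (k : ℝ) - 6) / 3)
              * (t : ℝ) ^ (((k : ℝ) - 3) / 3)
              * (n : ℝ) ^ ((4 * (k : ℝ) + 12) / 9))) ∧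
        (k ≡ 1 [MOD 3] →
          ((dotChains E α).card : ℝ) ≤
            C * (Real.logb 2 (n : ℝ) ^ ((2 * (k : ℝ) - 2) / 3)
              * (t : ℝ) ^ (((k : ℝ) - 1) / 3)
              * (n : ℝ) ^ ((4 * (k : ℝ) + 8) / 9))) ∧
        (k ≡ 2 [MOD 3] →
          ((dotChains E α).card : ℝ) ≤
            C * (Real.logb 2 (n : ℝ) ^ ((2 * (k : ℝ) + 2) / 3)
              * (t : ℝ) ^ (((k : ℝ) + 1) / 3)
              * (n : ℝ) ^ ((4 * (k : ℝ) + 4) / 9))) := by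
  -- `n > 1` makes the base-2 logarithm at least 1; the power of 11 is at most `k + 1` in every
  -- residue class.
  refine ⟨11 ^ (k + 1), 1, fun n t E α hn hE ht hα => ?_⟩
  have hB := fun (a : ℝ) (ha : a ≠ 0) => hE ▸ card_dot_pairs_le E ha
  refine ⟨fun hmod => ?_, fun hmod => ?_, fun hmod => ?_⟩
  -- `hk` rules out `k = 0`, the one multiple of 3 not of this form.
  · obtain ⟨j, rfl⟩ : ∃ j, k = 3 * j + 3 := ⟨k / 3 - 1, by unfold Nat.ModEq at hmod; omega⟩
    refine le_mul_logb_rpow_mul hn (by omega) (card_dotChains_le_of_mod_zero ht hB j α hα) ?_ ?_ ?_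
      <;> push_cast
    · have : (0 : ℝ) ≤ j := Nat.cast_nonneg _
      linarith
    · ring
    · ring
  · obtain ⟨j, rfl⟩ : ∃ j, k = 3 * j + 1 := ⟨k / 3, by unfold Nat.ModEq at hmod; omega⟩
    refine le_mul_logb_rpow_mul hn (by omega) (card_dotChains_le_of_mod_one ht hB j α hα) ?_ ?_ ?_
      <;> push_cast
    · have : (0 : ℝ) ≤ j := Nat.cast_nonneg _
      linarith
    · ring
    · ring
  · obtain ⟨j, rfl⟩ : ∃ j, k = 3 * j + 2 := ⟨k / 3, by unfold Nat.ModEq at hmod; omega⟩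
    refine le_mul_logb_rpow_mul hn (by omega) (card_dotChains_le_of_mod_two ht hB j α hα) ?_ ?_ ?_
      <;> push_cast
    · have : (0 : ℝ) ≤ j := Nat.cast_nonneg _
      linarith
    · ring
    · ring
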